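/- Let $N > k \ge 2$ be integers, write $\llbracket m, n\rrbracket = \{m, m+1, \dots, n\}$ (empty if $n<m$) and $\llbracket N\rrbracket = \llbracket 1,N\rrbracket$, and let $\Delta^N = \{\lambda \in \mathbb{R}^N : \lambda \ge 0,\ \sum_{v=1}^N \lambda_v = 1\}$ and $$\operatorname{SOS}k(N) = \bigcup_{i=1}^{N-k+1} \{\lambda \in \Delta^N : \lambda_j = 0 \text{ for all } j \in \llbracket N\rrbracket \setminus \llbracket i, i+k-1\rrbracket\}.$$ Put $b = \lceil \log_2(N-k+1)\rceil$ and, for $i \in \llbracket 0, b-1\rrbracket$ and integers $j \ge 0$, let $\alpha^i = \left\lceil \frac{k-1+2^{b-i-1}}{2^{b-i}} \right\rceil$, $$A^{i,j} = \llbracket 1 + j 2^{b-i}, (2j+1)2^{b-i-1}\rrbracket, \qquad B^{i,j} = \llbracket (2j+1)2^{b-i-1}+k, (j+1)2^{b-i}+k-1\rrbracket .$$ Let $I = \{(i,p) : 0 \le i \le b-1,\ 0 \le p \le \min\{\alpha^i-1, 2^i-1\}\}$ and, for $(i,p) \in I$, with $m_{i,p} = \left\lfloor \frac{2^i-1-p}{2\alpha^i}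 \right\rfloor$ and $n_{i,p} = \left\lfloor \frac{2^i-1-p}{2\alpha^i} - \frac12 \right\rfloor$ (a union over $q$ from $0$ to $-1$ is empty), $$L^{i,p} = \bigcup_{q=0}^{m_{i,p}} A^{i,2q\alpha^i+p} \cup \bigcup_{q=0}^{n_{i,p}} B^{i,(2q+1)\alpha^i+p}, \qquad R^{i,p} = \bigcup_{q=0}^{m_{i,p}} B^{i,2q\alpha^i+p} \cup \bigcup_{q=0}^{n_{i,p}} A^{i,(2q+1)\alpha^i+p}.$$ Then the system in the variables $\lambda \in \Delta^N$ and $z \in \mathbb{R}^I$, $$\sum_{v \in L^{i,p} \cap \llbracket N\rrbracket} \lambda_v \le z_{i,p}, \qquad \sum_{v \in R^{i,p} \cap \llbracket N\rrbracket} \lambda_v \le 1 - z_{i,p}, \qquad z_{i,p} \in \{0,1\} \qquad ((i,p) \in I),$$ is an ideal, non-extended MIP formulation of $\operatorname{SOS}k(N)$. That is: it has no continuous variables other than $\lambda$; a vector $\lambda$ lies in $\operatorname{SOS}k(N)$ if and only if there is a $z$ such that $(\lambda,z)$ satisfies the system; and each extreme point $(\lambda,z)$ of its LP relaxation (where $z_{i,p}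 \in \{0,1\}$ is replaced by $0 \le z_{i,p} \le 1$) has $z_{i,p} \in \{0,1\}$ for all $(i,p) \in I$. Moreover, the number $|I|$ of binary variables is at most $\lceil \log_2(N-k+1)\rceil + k - 2$, and the number $2|I|$ of linear inequality constraints displayed above (not counting those that describe $\lambda \in \Delta^N$) is at most $2\lceil \log_2(N-k+1)\rceil + 2k - 4$. -/

import Mathlib

/-! ### Mixed-integer programs in the variables `x ∈ Δ^ι` and binary variables `z` -/

/-- The data of a non-extended MIP: the only continuous variables are the coordinates of `x`,
which ranges over the simplex `Δ^ι`; `β` indexes the binary variables `z`, and `ρ` indexes the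
linear constraints
`∑ v, xCoeff r v * x v + ∑ s, zCoeff r s * z s ≤ rhs r` that are imposed besides `x ∈ Δ^ι`. -/
structure SimplexMIP (ι β ρ : Type*) where
  /-- coefficients of the continuous variables -/
  xCoeff : ρ → ι → ℝ
  /-- coefficients of the binary variables -/
  zCoeff : ρ → β → ℝ
  /-- right-hand sides -/
  rhs : ρ → ℝ

namespace SimplexMIP

/-- The LP relaxation: each condition `z s ∈ {0, 1}` is relaxed to `0 ≤ z s ≤ 1`. -/
def lpRelaxation {ι β ρ : Type*} [Fintype ι] [Fintype β] (M : SimplexMIP ι β ρ) :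
    Set ((ι → ℝ) × (β → ℝ)) :=
  {y | y.1 ∈ stdSimplex ℝ ι ∧
    (∀ r, ∑ v, M.xCoeff r v * y.1 v + ∑ s, M.zCoeff r s * y.2 s ≤ M.rhs r) ∧
    ∀ s, 0 ≤ y.2 s ∧ y.2 s ≤ 1}

/-- The points that satisfy the integrality conditions `z s ∈ {0, 1}`. -/
def integral (ι β : Type*) : Set ((ι → ℝ) × (β → ℝ)) :=
  {y | ∀ s, y.2 s = 0 ∨ y.2 s = 1}

/-- The feasible set of the MIP. -/
def feasible {ι β ρ : Type*} [Fintype ι] [Fintype β] (M : SimplexMIP ι β ρ) :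
    Set ((ι → ℝ) × (β → ℝ)) :=
  M.lpRelaxation ∩ integral ι β

/-- `M` is a MIP formulation of `X`: the points of `X` are exactly those `x` that can be completed
by binary values `z` to a feasible point. -/
def IsFormulationOf {ι β ρ : Type*} [Fintype ι] [Fintype β] (M : SimplexMIP ι β ρ)
    (X : Set (ι → ℝ)) : Prop :=
  Prod.fst '' M.feasible = X

/-- `M` is ideal: each extreme point of its LP relaxation satisfies the integrality conditions. -/
def IsIdeal {ι β ρ : Type*} [Fintype ι] [Fintype β] (M : SimplexMIP ι β ρ) : Prop :=
  M.lpRelaxation.extremePoints ℝ ⊆ integral ι β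

end SimplexMIP

namespace SOS

/-- The index set `{1, …, N}`. -/
abbrev J (N : ℕ) : Type := ↥(Finset.Icc 1 N)

/-- The generalized special ordered set constraint `SOS k(N)`. -/
def sosk (k N : ℕ) : Set (J N → ℝ) :=
  ⋃ i ∈ Set.Icc 1 (N - k + 1),
    {x | x ∈ stdSimplex ℝ (J N) ∧ ∀ j : J N, (j : ℕ) ∉ Set.Icc i (i + k - 1) → x j = 0}

/-- `A^{i,j}` (used for `i < b`). -/
def A (b i j : ℕ) : Set ℕ :=
  Set.Icc (1 + j * 2 ^ (b - i)) ((2 * j + 1) * 2 ^ (b - i - 1))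

/-- `B^{i,j}` (used for `i < b`). -/
def B (b k i j : ℕ) : Set ℕ :=
  Set.Icc ((2 * j + 1) * 2 ^ (b - i - 1) + k) ((j + 1) * 2 ^ (b - i) + k - 1)

/-- `α^i = ⌈(k - 1 + 2^(b-i-1)) / 2^(b-i)⌉` (used for `i < b`); it is at least `1`. -/
def α (b k i : ℕ) : ℕ :=
  ⌈((k : ℚ) - 1 + 2 ^ (b - i - 1)) / 2 ^ (b - i)⌉₊

/-- The values `q = 0, …, ⌊(2^i - 1 - p) / (2 α^i)⌋`. -/
def evenRange (b k i p : ℕ) : Set ℕ :=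
  {q | (q : ℤ) ≤ ⌊((2 : ℚ) ^ i - 1 - p) / (2 * α b k i)⌋}

/-- The values `q = 0, …, ⌊(2^i - 1 - p) / (2 α^i) - 1/2⌋` (none if the upper end is `-1`). -/
def oddRange (b k i p : ℕ) : Set ℕ :=
  {q | (q : ℤ) ≤ ⌊((2 : ℚ) ^ i - 1 - p) / (2 * α b k i) - 1 / 2⌋}

/-- The left part `L^{i,p}` of a merged biclique. -/
def L (b k i p : ℕ) : Set ℕ :=
  (⋃ q ∈ evenRange b k i p, A b i (2 * q * α b k i + p)) ∪
    ⋃ q ∈ oddRange b k i p, B b k i ((2 * q + 1) * α b k i + p)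

/-- The right part `R^{i,p}` of a merged biclique. -/
def R (b k i p : ℕ) : Set ℕ :=
  (⋃ q ∈ evenRange b k i p, B b k i (2 * q * α b k i + p)) ∪
    ⋃ q ∈ oddRange b k i p, A b i ((2 * q + 1) * α b k i + p)

/-- `b = ⌈log₂ (N - k + 1)⌉`. -/
noncomputable def bits (N k : ℕ) : ℕ :=
  ⌈Real.logb 2 ((N : ℝ) - k + 1)⌉₊

/-- The pairs `(i, p)` with `0 ≤ i ≤ b - 1` and `0 ≤ p ≤ min {α^i - 1, 2^i - 1}`, where
`b = ⌈log₂ (N - k + 1)⌉`. -/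
abbrev Idx (N k : ℕ) : Type :=
  Σ i : Fin (bits N k), Fin (min (α (bits N k) k i) (2 ^ (i : ℕ)))

/-- The system, with one binary variable `z_{i,p}` for each pair `(i, p)` and the constraints
`∑_{v ∈ L^{i,p} ∩ {1,…,N}} x_v - z_{i,p} ≤ 0` (indexed by `Sum.inl (i, p)`) and
`∑_{v ∈ R^{i,p} ∩ {1,…,N}} x_v + z_{i,p} ≤ 1` (indexed by `Sum.inr (i, p)`). -/
noncomputable def mip (N k : ℕ) : SimplexMIP (J N) (Idx N k) (Idx N k ⊕ Idx N k) where
  xCoeff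
    | .inl s, v => (L (bits N k) k s.1 s.2).indicator 1 (v : ℕ)
    | .inr s, v => (R (bits N k) k s.1 s.2).indicator 1 (v : ℕ)
  zCoeff
    | .inl s, t => if t = s then -1 else 0
    | .inr s, t => if t = s then 1 else 0
  rhs
    | .inl _ => 0
    | .inr _ => 1

end SOS

/-! A point of the simplex lies in `SOS.sosk k N` iff no two support indices differ by `k` or more,
so these conflicts must be covered by bicliques `L × R`. With `x = u - 1` and `y = v - k`, the
conflict `u + k ≤ v` reads `x < y`; a dyadic interval with `x` in its first half and `y` in its
second puts `(u, v)` in some `A^{i,j} × B^{i,j}` (`exists_dyadic_split`).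

At level `i`, the blocks whose `j` agree mod `α^i` are merged, with sides swapped at every other
block. The size of `α^i` keeps opposite sides at distance at least `k` (`far_of_mem_L_of_mem_R`), so
no false conflict arises. In particular the sides are disjoint, which alone makes the formulation
ideal (`isIdeal_ofPairs`). The number of variables is bounded by `∑ α^i`, a telescoping sum of
rounded halves (`sum_rounded_halves`). -/

open Filter Topology

/-! ### Formulations given by pairs of vertex sets -/

namespace SimplexMIP

/-- The formulation with one binary variable `z s` for each pair `(L s, R s)` of vertex sets and
the constraints `x(L s) ≤ z s`, `x(R s) ≤ 1 - z s`. -/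
noncomputable def ofPairs {ι β : Type*} [DecidableEq β] (L R : β → Set ι) :
    SimplexMIP ι β (β ⊕ β) where
  xCoeff
    | .inl s, v => (L s).indicator 1 v
    | .inr s, v => (R s).indicator 1 v
  zCoeff
    | .inl s, t => if t = s then -1 else 0
    | .inr s, t => if t = s then 1 else 0
  rhs
    | .inl _ => 0
    | .inr _ => 1

/-- The total weight `x(S)` of a set of coordinates. -/
noncomputable def weight {ι : Type*} [Fintype ι] (S : Set ι) (x : ι → ℝ) : ℝ :=
  ∑ v, S.indicator 1 v * x v

section

variable {ι β : Type*}

lemma indicator_one_nonneg (S : Set ι) (v : ι) : (0 : ℝ) ≤ S.indicator 1 v :=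
  Set.indicator_nonneg (fun _ _ => zero_le_one) v

lemma indicator_one_le_one (S : Set ι) (v : ι) : (S.indicator 1 v : ℝ) ≤ 1 :=
  Set.indicator_le_self' (f := fun _ => (1 : ℝ)) (fun _ _ => zero_le_one) v

variable [Fintype ι]

lemma weight_add_smul (S : Set ι) (x d : ι → ℝ) (ε : ℝ) :
    weight S (x + ε • d) = weight S x + ε * weight S d := by
  simp only [weight, Finset.mul_sum, ← Finset.sum_add_distrib]
  refine Finset.sum_congr rfl fun v _ => ?_
  simp only [Pi.add_apply, Pi.smul_apply, smul_eq_mul]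
  ring

lemma weight_nonneg (S : Set ι) {x : ι → ℝ} (hx : ∀ v, 0 ≤ x v) : 0 ≤ weight S x :=
  Finset.sum_nonneg fun v _ => mul_nonneg (indicator_one_nonneg S v) (hx v)

lemma weight_le_one (S : Set ι) {x : ι → ℝ} (hx : x ∈ stdSimplex ℝ ι) : weight S x ≤ 1 := by
  rw [← hx.2]
  exact Finset.sum_le_sum fun v _ => mul_le_of_le_one_left (hx.1 v) (indicator_one_le_one S v)

lemma le_weight {S : Set ι} {x : ι → ℝ} (hx : ∀ v, 0 ≤ x v) {u : ι} (hu : u ∈ S) :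
    x u ≤ weight S x := by
  have h := Finset.single_le_sum (f := fun v => (S.indicator 1 v : ℝ) * x v)
    (fun v _ => mul_nonneg (indicator_one_nonneg S v) (hx v)) (Finset.mem_univ u)
  simp only [Set.indicator_of_mem hu, Pi.one_apply, one_mul] at h
  exact h

lemma weight_eq_zero {S : Set ι} {x : ι → ℝ} (h : ∀ u ∈ S, x u = 0) : weight S x = 0 := by
  refine Finset.sum_eq_zero fun v _ => ?_
  by_cases hv : v ∈ S
  · simp [h v hv]
  · simp [hv]

lemma weight_single [DecidableEq ι] (S : Set ι) (u : ι) (c : ℝ) :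
    weight S (Pi.single u c) = S.indicator 1 u * c := by
  rw [weight, Finset.sum_eq_single u]
  · simp
  · intro v _ hv
    simp [hv]
  · simp

/-- The total weight is 1, so `S ∪ T` leaves none for other coordinates. -/
lemma eq_zero_of_weight_add_weight_eq_one {S T : Set ι} {x : ι → ℝ} (hx : x ∈ stdSimplex ℝ ι)
    (hST : Disjoint S T) (h : weight S x + weight T x = 1) {u : ι} (hS : u ∉ S) (hT : u ∉ T) :
    x u = 0 := by
  have hle : ∀ v, (S.indicator 1 v : ℝ) * x v + T.indicator 1 v * x v ≤ x v := by
    intro v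
    by_cases h1 : v ∈ S
    · simp [h1, Set.disjoint_left.1 hST h1]
    · by_cases h2 : v ∈ T
      · simp [h1, h2]
      · simpa [h1, h2] using hx.1 v
  have hsum : ∑ v, ((S.indicator 1 v : ℝ) * x v + T.indicator 1 v * x v) = ∑ v, x v := by
    rw [Finset.sum_add_distrib, hx.2]
    exact h
  have := (Finset.sum_eq_sum_iff_of_le fun v _ => hle v).1 hsum u (Finset.mem_univ u)
  simpa [hS, hT] using this.symm

variable [Fintype β]

lemma mem_lpRelaxation_ofPairs [DecidableEq β] {L R : β → Set ι} {y : (ι → ℝ) × (β → ℝ)} :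
    y ∈ (ofPairs L R).lpRelaxation ↔ y.1 ∈ stdSimplex ℝ ι ∧
      ∀ s, weight (L s) y.1 ≤ y.2 s ∧ weight (R s) y.1 + y.2 s ≤ 1 := by
  have hl : ∀ s, ∑ v, (ofPairs L R).xCoeff (.inl s) v * y.1 v = weight (L s) y.1 := fun _ => rfl
  have hr : ∀ s, ∑ v, (ofPairs L R).xCoeff (.inr s) v * y.1 v = weight (R s) y.1 := fun _ => rfl
  have zl : ∀ s, ∑ t, (ofPairs L R).zCoeff (.inl s) t * y.2 t = - y.2 s := by
    intro s
    simp [ofPairs]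
  have zr : ∀ s, ∑ t, (ofPairs L R).zCoeff (.inr s) t * y.2 t = y.2 s := by
    intro s
    simp [ofPairs]
  have bl : ∀ s, (ofPairs L R).rhs (.inl s) = 0 := fun _ => rfl
  have br : ∀ s, (ofPairs L R).rhs (.inr s) = 1 := fun _ => rfl
  simp only [lpRelaxation, Set.mem_ofPred_eq, Sum.forall, hl, hr, zl, zr, bl, br]
  constructor
  · rintro ⟨hx, ⟨h1, h2⟩, -⟩
    exact ⟨hx, fun s => ⟨by linarith [h1 s], h2 s⟩⟩
  · rintro ⟨hx, h⟩
    refine ⟨hx, ⟨fun s => by linarith [(h s).1], fun s => (h s).2⟩, fun s => ⟨?_, ?_⟩⟩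
    · linarith [(h s).1, weight_nonneg (L s) hx.1]
    · linarith [(h s).2, weight_nonneg (R s) hx.1]

/-- The pairs `(L s, R s)` describe the points of the simplex whose support contains no element of
any `L s × R s`. -/
lemma isFormulationOf_ofPairs [DecidableEq β] (L R : β → Set ι) :
    (ofPairs L R).IsFormulationOf {x | x ∈ stdSimplex ℝ ι ∧
      ∀ s, ∀ u ∈ L s, ∀ v ∈ R s, x u = 0 ∨ x v = 0} := by
  classical
  ext x
  constructor
  · rintro ⟨y, ⟨hy, hz⟩, rfl⟩
    obtain ⟨hx, h⟩ := mem_lpRelaxation_ofPairs.1 hy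
    refine ⟨hx, fun s u hu v hv => ?_⟩
    obtain h0 | h1 := hz s
    · left
      linarith [hx.1 u, le_weight hx.1 hu, (h s).1]
    · right
      linarith [hx.1 v, le_weight hx.1 hv, (h s).2]
  · rintro ⟨hx, h⟩
    refine ⟨(x, fun s => if ∀ u ∈ L s, x u = 0 then 0 else 1), ⟨?_, ?_⟩, rfl⟩
    · refine mem_lpRelaxation_ofPairs.2 ⟨hx, fun s => ?_⟩
      by_cases hs : ∀ u ∈ L s, x u = 0
      · simp only [if_pos hs, weight_eq_zero hs, add_zero, le_refl, weight_le_one (R s) hx,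
          and_self]
      · have hR : ∀ v ∈ R s, x v = 0 := by
          push Not at hs
          obtain ⟨u, hu, hxu⟩ := hs
          exact fun v hv => (h s u hu v hv).resolve_left hxu
        simp only [if_neg hs, weight_eq_zero hR, zero_add, le_refl, weight_le_one (L s) hx,
          and_self]
    · intro s
      by_cases hs : ∀ u ∈ L s, x u = 0
      · exact Or.inl (if_pos hs)
      · exact Or.inr (if_neg hs)

/-! ### Extreme points and idealness -/

/-- A direction in which one can move both ways inside a set vanishes at an extreme point. -/
lemma eq_zero_of_mem_extremePoints {E : Type*} [AddCommGroup E] [Module ℝ E] {A : Set E} {y d : E}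
    (hy : y ∈ A.extremePoints ℝ) (h : ∀ᶠ ε : ℝ in 𝓝 0, y + ε • d ∈ A) : d = 0 := by
  obtain ⟨r, hr, hball⟩ := Metric.eventually_nhds_iff.1 h
  have h1 : y + (r / 2) • d ∈ A := hball (by rw [Real.dist_eq, sub_zero, abs_of_pos] <;> linarith)
  have h2 : y + (-(r / 2)) • d ∈ A :=
    hball (by rw [Real.dist_eq, sub_zero, abs_neg, abs_of_pos] <;> linarith)
  have hseg : y ∈ openSegment ℝ (y + (r / 2) • d) (y + (-(r / 2)) • d) := by
    refine ⟨1 / 2, 1 / 2, by norm_num, by norm_num, by norm_num, ?_⟩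
    module
  have := hy.2 h1 h2 hseg
  have h0 : (r / 2) • d = 0 := by simpa using this
  exact (smul_eq_zero.1 h0).resolve_left (by positivity)

lemma eventually_add_mul_le {a c r : ℝ} (h : a ≤ r) (h' : a = r → c = 0) :
    ∀ᶠ ε : ℝ in 𝓝 0, a + ε * c ≤ r := by
  obtain h | h := h.lt_or_eq
  · have hc : Tendsto (fun ε : ℝ => a + ε * c) (𝓝 0) (𝓝 (a + 0 * c)) :=
      Continuous.tendsto (by fun_prop) 0
    rw [zero_mul, add_zero] at hc
    exact (hc.eventually_lt_const h).mono fun _ => le_of_lt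
  · simp [h' h, h]

/-- Slack constraints survive small moves, so only the tight ones restrict `(d, δ)`; finitely many
constraints give a common range of `ε`. -/
lemma eventually_mem_lpRelaxation [DecidableEq β] {L R : β → Set ι} {x d : ι → ℝ}
    {z δ : β → ℝ} (hy : (x, z) ∈ (ofPairs L R).lpRelaxation) (hd : ∑ v, d v = 0)
    (h0 : ∀ v, x v = 0 → d v = 0) (hL : ∀ s, weight (L s) x = z s → weight (L s) d = δ s)
    (hR : ∀ s, weight (R s) x + z s = 1 → weight (R s) d + δ s = 0) :
    ∀ᶠ ε : ℝ in 𝓝 0, (x, z) + ε • (d, δ) ∈ (ofPairs L R).lpRelaxation := by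
  obtain ⟨hx, h⟩ := mem_lpRelaxation_ofPairs.1 hy
  have e0 : ∀ᶠ ε : ℝ in 𝓝 0, ∀ v, -x v + ε * (-d v) ≤ 0 :=
    eventually_all.2 fun v => eventually_add_mul_le (by linarith [hx.1 v])
      fun hv => by rw [h0 v (by linarith), neg_zero]
  have e1 : ∀ᶠ ε : ℝ in 𝓝 0, ∀ s,
      (weight (L s) x - z s) + ε * (weight (L s) d - δ s) ≤ 0 :=
    eventually_all.2 fun s => eventually_add_mul_le (by linarith [(h s).1])
      fun hs => by rw [hL s (by linarith), sub_self]
  have e2 : ∀ᶠ ε : ℝ in 𝓝 0, ∀ s,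
      (weight (R s) x + z s) + ε * (weight (R s) d + δ s) ≤ 1 :=
    eventually_all.2 fun s => eventually_add_mul_le (h s).2 (hR s)
  filter_upwards [e0, e1, e2] with ε h0 h1 h2
  refine mem_lpRelaxation_ofPairs.2 ⟨⟨fun v => ?_, ?_⟩, fun s => ?_⟩
  · have := h0 v
    simp only [Prod.fst_add, Prod.smul_fst, Pi.add_apply, Pi.smul_apply, smul_eq_mul]
    linarith
  · simp only [Prod.fst_add, Prod.smul_fst, Pi.add_apply, Pi.smul_apply, smul_eq_mul,
      Finset.sum_add_distrib, ← Finset.mul_sum, hd, mul_zero, add_zero]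
    exact hx.2
  · simp only [Prod.fst_add, Prod.smul_fst, Prod.snd_add, Prod.smul_snd, Pi.add_apply,
      Pi.smul_apply, smul_eq_mul, weight_add_smul]
    constructor <;> linarith [h1 s, h2 s]

/-- If `L s` and `R s` are disjoint for each `s`, then the formulation is ideal. -/
lemma isIdeal_ofPairs [DecidableEq β] {L R : β → Set ι} (hLR : ∀ s, Disjoint (L s) (R s)) :
    (ofPairs L R).IsIdeal := by
  classical
  rintro ⟨x, z⟩ hy
  obtain ⟨hx, h⟩ := mem_lpRelaxation_ofPairs.1 hy.1
  have huniq : ∀ u v, x u ≠ 0 → x v ≠ 0 → u = v := by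
    intro u v hu hv
    by_contra huv
    set d : ι → ℝ := Pi.single u 1 + (-1 : ℝ) • Pi.single v 1 with hd
    have hwd : ∀ S : Set ι, weight S d = S.indicator 1 u - S.indicator 1 v := by
      intro S
      rw [hd, weight_add_smul, weight_single, weight_single]
      ring
    -- Shift weight between `u` and `v`, and let each `z s` follow whichever of its constraints is
    -- tight.
    have key := eq_zero_of_mem_extremePoints hy (eventually_mem_lpRelaxation (d := d)
      (δ := fun s => if weight (L s) x = z s then weight (L s) d else - weight (R s) d) hy.1
      ?_ ?_ ?_ ?_)
    · have : d u = 0 := congrFun (congrArg Prod.fst key) u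
      simp [hd, huv] at this
    · simp [hd, Finset.sum_add_distrib]
    · intro w hw
      have h1 : w ≠ u := fun e => hu (e ▸ hw)
      have h2 : w ≠ v := fun e => hv (e ▸ hw)
      simp [hd, h1, h2]
    · intro s hs
      simp [hs]
    · intro s hs
      by_cases hl : weight (L s) x = z s
      -- If both constraints are tight, the support lies in the disjoint union of `L s` and `R s`,
      -- so the two demands on `δ s` agree.
      · have hone : weight (L s) x + weight (R s) x = 1 := by linarith
        have hmem : ∀ w, x w ≠ 0 →
            ((L s).indicator 1 w : ℝ) + (R s).indicator 1 w = 1 := by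
          intro w hw
          by_cases h1 : w ∈ L s
          · simp [h1, Set.disjoint_left.1 (hLR s) h1]
          · by_cases h2 : w ∈ R s
            · simp [h1, h2]
            · exact absurd (eq_zero_of_weight_add_weight_eq_one hx (hLR s) hone h1 h2) hw
        simp only [hl, if_true, hwd]
        linarith [hmem u hu, hmem v hv]
      · simp [hl]
  obtain ⟨u, hu⟩ : ∃ u, x u ≠ 0 := by
    by_contra! hall
    have := hx.2
    simp [hall] at this
  have hxu : x = Pi.single u 1 := by
    have h0 : ∀ v, v ≠ u → x v = 0 := fun v hv => by
      by_contra hne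
      exact hv (huniq v u hne hu)
    have h1 : x u = 1 := by
      rw [← hx.2, Finset.sum_eq_single u (fun v _ hv => h0 v hv) (by simp)]
    ext v
    by_cases hv : v = u
    · subst hv
      simp [h1]
    · simp [hv, h0 v hv]
  intro s
  by_contra! hs
  simp only at hs
  have hw : ∀ S : Set ι, weight S x = S.indicator 1 u := by
    intro S
    rw [hxu, weight_single, mul_one]
  have hdich : ∀ S : Set ι, weight S x = 0 ∨ weight S x = 1 := by
    intro S
    rw [hw]
    by_cases h : u ∈ S <;> simp [h]
  obtain ⟨hl, hr⟩ := h s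
  -- At a vertex of the simplex all weights are 0 or 1, so a fractional `z s` has both constraints
  -- slack and can move alone.
  have hl' : weight (L s) x ≠ z s := by
    intro e
    obtain h' | h' := hdich (L s)
    · exact hs.1 (by linarith)
    · exact hs.2 (by linarith)
  have hr' : weight (R s) x + z s ≠ 1 := by
    intro e
    obtain h' | h' := hdich (R s)
    · exact hs.2 (by linarith)
    · exact hs.1 (by linarith)
  have key := eq_zero_of_mem_extremePoints hy (eventually_mem_lpRelaxation (d := 0)
    (δ := Pi.single s 1) hy.1 (by simp) (by simp) ?_ ?_)
  · have : (Pi.single s 1 : β → ℝ) s = 0 := congrFun (congrArg Prod.snd key) s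
    simp at this
  · intro t ht
    have hts : t ≠ s := fun e => hl' (e ▸ ht)
    simp [weight, hts]
  · intro t ht
    have hts : t ≠ s := fun e => hr' (e ▸ ht)
    simp [weight, hts]

end

end SimplexMIP

/-! ### `SOS k(N)` as a pairwise condition -/

namespace SOS

lemma mip_eq_ofPairs (N k : ℕ) : mip N k = SimplexMIP.ofPairs
    (fun s : Idx N k => {v : J N | (v : ℕ) ∈ L (bits N k) k s.1 s.2})
    (fun s : Idx N k => {v : J N | (v : ℕ) ∈ R (bits N k) k s.1 s.2}) := by
  unfold mip SimplexMIP.ofPairs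
  congr 1 <;> ext r <;> cases r <;> rfl

lemma mem_sosk_iff {k N : ℕ} (hk : 2 ≤ k) (hN : k < N) {x : J N → ℝ} :
    x ∈ sosk k N ↔ x ∈ stdSimplex ℝ (J N) ∧
      ∀ u v : J N, (u : ℕ) + k ≤ v → x u = 0 ∨ x v = 0 := by
  simp only [sosk, Set.mem_iUnion, Set.mem_ofPred_eq, Set.mem_Icc, exists_prop]
  constructor
  · rintro ⟨i, hi, hx, h⟩
    refine ⟨hx, fun u v huv => ?_⟩
    by_cases hu : i ≤ u
    · exact Or.inr (h v (by omega))
    · exact Or.inl (h u (by omega))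
  · rintro ⟨hx, h⟩
    obtain ⟨w, hw⟩ : ∃ u, x u ≠ 0 := by
      by_contra! hall
      have := hx.2
      simp [hall] at this
    obtain ⟨u, hu, hmin⟩ := Set.exists_min_image {u | x u ≠ 0} (fun u : J N => (u : ℕ))
      (Set.toFinite _) ⟨w, hw⟩
    have hu1 := Finset.mem_Icc.1 u.2
    -- The window starts at the least support index, capped so that it ends by `N`.
    refine ⟨min u (N - k + 1), by omega, hx, fun v hv => ?_⟩
    by_contra hne
    have h1 : (u : ℕ) ≤ v := hmin v hne
    have h2 : ¬ (u : ℕ) + k ≤ v := fun hle => (h u v hle).elim hu hne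
    have hv1 := Finset.mem_Icc.1 v.2
    omega

/-! ### The size of `α^i` and the number of binary variables -/

lemma two_pow_sub {b i : ℕ} (hi : i < b) : 2 ^ (b - i) = 2 * 2 ^ (b - i - 1) := by
  rw [← pow_succ']
  congr 1
  omega

lemma le_α_mul {b k i : ℕ} (hk : 2 ≤ k) :
    k - 1 + 2 ^ (b - i - 1) ≤ α b k i * 2 ^ (b - i) := by
  have h : ((k : ℚ) - 1 + 2 ^ (b - i - 1)) / 2 ^ (b - i) ≤ α b k i := Nat.le_ceil _
  rw [div_le_iff₀ (by positivity)] at h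
  have h' : ((k - 1 + 2 ^ (b - i - 1) : ℕ) : ℚ) ≤ ((α b k i * 2 ^ (b - i) : ℕ) : ℚ) := by
    push_cast [Nat.cast_sub (by omega : 1 ≤ k)]
    exact h
  exact_mod_cast h'

lemma α_pos {b k i : ℕ} (hk : 2 ≤ k) : 0 < α b k i := by
  have h := le_α_mul (b := b) (i := i) hk
  rcases Nat.eq_zero_or_pos (α b k i) with h0 | h0
  · have := Nat.two_pow_pos (b - i - 1)
    rw [h0, zero_mul] at h
    omega
  · exact h0

lemma α_le {b k i : ℕ} (hk : 2 ≤ k) :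
    α b k i ≤ (k - 2 + 2 ^ (b - i - 1)) / 2 ^ (b - i) + 1 := by
  refine Nat.ceil_le.2 ?_
  rw [div_le_iff₀ (by positivity)]
  have h := Nat.lt_mul_div_succ (k - 2 + 2 ^ (b - i - 1)) (Nat.two_pow_pos (b - i))
  have h' : k - 1 + 2 ^ (b - i - 1) ≤
      ((k - 2 + 2 ^ (b - i - 1)) / 2 ^ (b - i) + 1) * 2 ^ (b - i) := by
    rw [mul_comm]
    omega
  have h'' : ((k - 1 + 2 ^ (b - i - 1) : ℕ) : ℚ) ≤
      (((k - 2 + 2 ^ (b - i - 1)) / 2 ^ (b - i) + 1 : ℕ) : ℚ) * 2 ^ (b - i) := by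
    exact_mod_cast h'
  push_cast [Nat.cast_sub (by omega : 1 ≤ k)] at h'' ⊢
  exact h''

/-- Summing `n / 2 ^ m` rounded to a nearest integer over `m = 1, …, b`. -/
lemma sum_rounded_halves (n b : ℕ) :
    ∑ m ∈ Finset.range b, (n + 2 ^ m) / 2 ^ (m + 1) + n / 2 ^ b = n := by
  induction b with
  | zero => simp
  | succ b ih =>
    have h1 : (n + 2 ^ b) / 2 ^ (b + 1) = (n / 2 ^ b + 1) / 2 := by
      -- With `t = n / 2 ^ b`, the sum telescopes by `(t + 1) / 2 + t / 2 = t`.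
      rw [pow_succ, ← Nat.div_div_eq_div_mul, Nat.add_div_right _ (Nat.two_pow_pos b)]
    have h2 : n / 2 ^ (b + 1) = n / 2 ^ b / 2 := by
      rw [pow_succ, Nat.div_div_eq_div_mul]
    rw [Finset.sum_range_succ, h1, h2]
    omega

lemma card_Idx_le {N k : ℕ} (hk : 2 ≤ k) : Fintype.card (Idx N k) ≤ bits N k + (k - 2) := by
  rw [Fintype.card_sigma]
  simp only [Fintype.card_fin]
  rw [Fin.sum_univ_eq_sum_range (fun i => min (α (bits N k) k i) (2 ^ i))]
  generalize bits N k = b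
  calc ∑ i ∈ Finset.range b, min (α b k i) (2 ^ i)
      ≤ ∑ i ∈ Finset.range b, ((k - 2 + 2 ^ (b - 1 - i)) / 2 ^ (b - 1 - i + 1) + 1) := by
        refine Finset.sum_le_sum fun i hi => (min_le_left _ _).trans ?_
        have hib := Finset.mem_range.1 hi
        have h := α_le (b := b) (i := i) hk
        rwa [show b - i - 1 = b - 1 - i by omega, show b - i = b - 1 - i + 1 by omega] at h
    _ = ∑ m ∈ Finset.range b, ((k - 2 + 2 ^ m) / 2 ^ (m + 1) + 1) :=
        Finset.sum_range_reflect (fun m => (k - 2 + 2 ^ m) / 2 ^ (m + 1) + 1) b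
    _ ≤ b + (k - 2) := by
        have := sum_rounded_halves (k - 2) b
        rw [Finset.sum_add_distrib, Finset.sum_const, Finset.card_range, smul_eq_mul, mul_one,
          add_comm]
        exact Nat.add_le_add_left ((Nat.le_add_right _ _).trans this.le) b

lemma logb_nonneg {N k : ℕ} (hN : k < N) : 0 ≤ Real.logb 2 ((N : ℝ) - k + 1) := by
  have : (k : ℝ) < N := by exact_mod_cast hN
  exact Real.logb_nonneg (by norm_num) (by linarith)

lemma bits_cast {N k : ℕ} (hN : k < N) :
    (bits N k : ℤ) = ⌈Real.logb 2 ((N : ℝ) - k + 1)⌉ :=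
  Int.natCast_ceil_eq_ceil (logb_nonneg hN)

lemma le_two_pow_bits {N k : ℕ} (hN : k < N) : N - k + 1 ≤ 2 ^ bits N k := by
  have hlt : (k : ℝ) < N := by exact_mod_cast hN
  have h : Real.logb 2 ((N : ℝ) - k + 1) ≤ bits N k := Nat.le_ceil _
  rw [Real.logb_le_iff_le_rpow (by norm_num) (by linarith), Real.rpow_natCast] at h
  have h' : ((N - k + 1 : ℕ) : ℝ) ≤ ((2 ^ bits N k : ℕ) : ℝ) := by
    push_cast [Nat.cast_sub hN.le]
    exact h
  exact_mod_cast h'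

/-! ### Distances inside merged bicliques -/

lemma mem_evenRange {b k i p q : ℕ} (hk : 2 ≤ k) (h : 2 * q * α b k i + p < 2 ^ i) :
    q ∈ evenRange b k i p := by
  have hα : (0 : ℚ) < α b k i := by exact_mod_cast α_pos hk
  refine Int.le_floor.2 ?_
  rw [le_div_iff₀ (by positivity)]
  have h' : ((2 * q * α b k i + p + 1 : ℕ) : ℚ) ≤ ((2 ^ i : ℕ) : ℚ) := by exact_mod_cast h
  push_cast at h' ⊢
  linarith

lemma mem_oddRange {b k i p q : ℕ} (hk : 2 ≤ k) (h : (2 * q + 1) * α b k i + p < 2 ^ i) :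
    q ∈ oddRange b k i p := by
  have hα : (0 : ℚ) < α b k i := by exact_mod_cast α_pos hk
  refine Int.le_floor.2 ?_
  rw [le_sub_iff_add_le, le_div_iff₀ (by positivity)]
  have h' : (((2 * q + 1) * α b k i + p + 1 : ℕ) : ℚ) ≤ ((2 ^ i : ℕ) : ℚ) := by exact_mod_cast h
  push_cast at h' ⊢
  linarith

/-- The range of `q` is dropped: the distance bounds hold for all blocks. -/
lemma exists_of_mem_L {b k i p u : ℕ} (h : u ∈ L b k i p) :
    (∃ q, u ∈ A b i (2 * q * α b k i + p)) ∨ ∃ q, u ∈ B b k i ((2 * q + 1) * α b k i + p) := by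
  simp only [L, Set.mem_union, Set.mem_iUnion, exists_prop] at h
  exact h.imp (fun ⟨q, _, h⟩ => ⟨q, h⟩) fun ⟨q, _, h⟩ => ⟨q, h⟩

lemma exists_of_mem_R {b k i p u : ℕ} (h : u ∈ R b k i p) :
    (∃ q, u ∈ B b k i (2 * q * α b k i + p)) ∨ ∃ q, u ∈ A b i ((2 * q + 1) * α b k i + p) := by
  simp only [R, Set.mem_union, Set.mem_iUnion, exists_prop] at h
  exact h.imp (fun ⟨q, _, h⟩ => ⟨q, h⟩) fun ⟨q, _, h⟩ => ⟨q, h⟩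

section

variable {b k i u v : ℕ}

/-- If the `B` block has the smaller index, the indices differ by at least `2 α^i`. That factor 2,
gained by swapping sides, is what absorbs the shift by `k` in `B`. -/
lemma far_of_mem_A_of_mem_B (hi : i < b) (hk : 2 ≤ k) {q q' p : ℕ}
    (hu : u ∈ A b i (2 * q * α b k i + p)) (hv : v ∈ B b k i (2 * q' * α b k i + p)) :
    u + k ≤ v ∨ v + k ≤ u := by
  have ha := le_α_mul (b := b) (i := i) hk
  simp only [A, B, Set.mem_Icc] at hu hv
  rw [two_pow_sub hi] at hu hv ha
  generalize 2 ^ (b - i - 1) = h at *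
  generalize α b k i = a at *
  rcases le_or_gt q q' with hq | hq
  · left
    obtain ⟨c, rfl⟩ := Nat.exists_eq_add_of_le hq
    have : 0 ≤ c * a * h := Nat.zero_le _
    nlinarith
  · right
    obtain ⟨c, rfl⟩ := Nat.exists_eq_add_of_lt hq
    have hc : 0 ≤ c * a * h := Nat.zero_le _
    obtain ⟨l, rfl⟩ := Nat.exists_eq_add_of_le hk
    have hv2 : v ≤ (2 * q' * a + p + 1) * (2 * h) + (1 + l) := by omega
    have ha' : 1 + l + h ≤ a * (2 * h) := by omega
    nlinarith

lemma far_of_mem_B_of_mem_A (hi : i < b) (hk : 2 ≤ k) {q q' p : ℕ}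
    (hu : u ∈ B b k i ((2 * q + 1) * α b k i + p))
    (hv : v ∈ A b i ((2 * q' + 1) * α b k i + p)) :
    u + k ≤ v ∨ v + k ≤ u := by
  have e : ∀ q, (2 * q + 1) * α b k i + p = 2 * q * α b k i + (α b k i + p) := fun q => by ring
  rw [e] at hu hv
  exact (far_of_mem_A_of_mem_B hi hk hv hu).symm

/-- Blocks have length `2 ^ (b - i - 1)`, so `le_α_mul` is exactly what makes an index gap of `α^i`
suffice. -/
lemma far_of_mem_A_of_mem_A (hi : i < b) (hk : 2 ≤ k) {j c : ℕ}
    (hu : u ∈ A b i j) (hv : v ∈ A b i (j + (c + 1) * α b k i)) : u + k ≤ v := by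
  have ha := le_α_mul (b := b) (i := i) hk
  simp only [A, Set.mem_Icc] at hu hv
  rw [two_pow_sub hi] at hu hv ha
  generalize 2 ^ (b - i - 1) = h at *
  generalize α b k i = a at *
  have hc : 0 ≤ c * a * h := Nat.zero_le _
  have ha' : k + h ≤ a * (2 * h) + 1 := by omega
  nlinarith

lemma far_of_mem_B_of_mem_B (hi : i < b) (hk : 2 ≤ k) {j c : ℕ}
    (hu : u ∈ B b k i j) (hv : v ∈ B b k i (j + (c + 1) * α b k i)) : u + k ≤ v := by
  have ha := le_α_mul (b := b) (i := i) hk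
  simp only [B, Set.mem_Icc] at hu hv
  rw [two_pow_sub hi] at hu hv ha
  generalize 2 ^ (b - i - 1) = h at *
  generalize α b k i = a at *
  have hc : 0 ≤ c * a * h := Nat.zero_le _
  have ha' : k + h ≤ a * (2 * h) + 1 := by omega
  have hu2 : u + 1 ≤ (j + 1) * (2 * h) + k := by omega
  nlinarith

/-- Elements of the two sides of a merged biclique are at distance at least `k`. -/
lemma far_of_mem_L_of_mem_R (hi : i < b) (hk : 2 ≤ k) {p : ℕ}
    (hu : u ∈ L b k i p) (hv : v ∈ R b k i p) : u + k ≤ v ∨ v + k ≤ u := by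
  have shift : ∀ {m n c : ℕ}, n = m + (c + 1) →
      n * α b k i + p = m * α b k i + p + (c + 1) * α b k i := by
    rintro m n c rfl
    ring
  rcases exists_of_mem_L hu with ⟨q, hu⟩ | ⟨q, hu⟩ <;>
    rcases exists_of_mem_R hv with ⟨q', hv⟩ | ⟨q', hv⟩
  · exact far_of_mem_A_of_mem_B hi hk hu hv
  · rcases le_or_gt q q' with hq | hq
    · rw [shift (m := 2 * q) (c := 2 * (q' - q)) (by omega)] at hv
      exact Or.inl (far_of_mem_A_of_mem_A hi hk hu hv)
    · rw [shift (m := 2 * q' + 1) (c := 2 * (q - q' - 1)) (by omega)] at hu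
      exact Or.inr (far_of_mem_A_of_mem_A hi hk hv hu)
  · rcases lt_or_ge q q' with hq | hq
    · rw [shift (m := 2 * q + 1) (c := 2 * (q' - q - 1)) (by omega)] at hv
      exact Or.inl (far_of_mem_B_of_mem_B hi hk hu hv)
    · rw [shift (m := 2 * q') (c := 2 * (q - q')) (by omega)] at hu
      exact Or.inr (far_of_mem_B_of_mem_B hi hk hv hu)
  · exact far_of_mem_B_of_mem_A hi hk hu hv

end

/-! ### Every conflict is covered -/

/-- Two numbers below `2 ^ b` are separated by a dyadic interval split at its midpoint. -/
lemma exists_dyadic_split {b x y : ℕ} (hxy : x < y) (hy : y < 2 ^ b) :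
    ∃ i < b, ∃ j < 2 ^ i, j * 2 ^ (b - i) ≤ x ∧ x < (2 * j + 1) * 2 ^ (b - i - 1) ∧
      (2 * j + 1) * 2 ^ (b - i - 1) ≤ y ∧ y < (j + 1) * 2 ^ (b - i) := by
  induction b generalizing x y with
  | zero => omega
  | succ b ih =>
    -- Drop the last bit: a split of the halves doubles to one of `x, y`; if the halves agree, only
    -- the last bit differs and the finest level works.
    rcases lt_or_ge (x / 2) (y / 2) with h | h
    · obtain ⟨i, hi, j, hj, h1, h2, h3, h4⟩ := ih h (by rw [pow_succ] at hy; omega)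
      refine ⟨i, by omega, j, hj, ?_⟩
      have e1 : 2 ^ (b + 1 - i) = 2 * 2 ^ (b - i) := by
        rw [← pow_succ']
        congr 1
        omega
      have e2 : 2 ^ (b + 1 - i - 1) = 2 * 2 ^ (b - i - 1) := by
        rw [← pow_succ']
        congr 1
        omega
      rw [e1, e2, mul_left_comm, mul_left_comm (2 * j + 1), mul_left_comm (j + 1)]
      omega
    · refine ⟨b, by omega, x / 2, by rw [pow_succ] at hy; omega, ?_⟩
      simp only [Nat.add_sub_cancel_left, Nat.sub_self, pow_one, pow_zero]
      omega

/-- A biclique `A^{i,j} × B^{i,j}` with `j < 2 ^ i` is part of a merged biclique. -/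
lemma mem_L_mem_R_or {b k i j u v : ℕ} (hk : 2 ≤ k) (hj : j < 2 ^ i) (hA : u ∈ A b i j)
    (hB : v ∈ B b k i j) :
    (u ∈ L b k i (j % α b k i) ∧ v ∈ R b k i (j % α b k i)) ∨
      (v ∈ L b k i (j % α b k i) ∧ u ∈ R b k i (j % α b k i)) := by
  have hdiv := Nat.div_add_mod' j (α b k i)
  generalize j % α b k i = p at *
  -- The parity of `j / α^i` decides which side receives `A^{i,j}`.
  obtain ⟨q, hq | hq⟩ := Nat.even_or_odd' (j / α b k i) <;> rw [hq] at hdiv <;> subst hdiv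
  · have hmem := mem_evenRange hk hj
    exact Or.inl ⟨Or.inl (Set.mem_biUnion hmem hA), Or.inl (Set.mem_biUnion hmem hB)⟩
  · have hmem := mem_oddRange hk hj
    exact Or.inr ⟨Or.inr (Set.mem_biUnion hmem hB), Or.inr (Set.mem_biUnion hmem hA)⟩

/-- Elements of `{1, …, N}` at distance at least `k` are separated by a merged biclique. -/
lemma exists_Idx_separating {N k u v : ℕ} (hk : 2 ≤ k) (hN : k < N) (hu : 1 ≤ u) (hv : v ≤ N)
    (huv : u + k ≤ v) : ∃ s : Idx N k,
      (u ∈ L (bits N k) k s.1 s.2 ∧ v ∈ R (bits N k) k s.1 s.2) ∨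
      (v ∈ L (bits N k) k s.1 s.2 ∧ u ∈ R (bits N k) k s.1 s.2) := by
  have hb := le_two_pow_bits hN
  obtain ⟨i, hi, j, hj, h1, h2, h3, h4⟩ :=
    exists_dyadic_split (b := bits N k) (x := u - 1) (y := v - k) (by omega) (by omega)
  have hA : u ∈ A (bits N k) i j := Set.mem_Icc.2 (by omega)
  have hB : v ∈ B (bits N k) k i j := Set.mem_Icc.2 (by omega)
  exact ⟨⟨⟨i, hi⟩, ⟨j % α (bits N k) k i,
    lt_min (Nat.mod_lt _ (α_pos hk)) ((Nat.mod_le _ _).trans_lt hj)⟩⟩,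
    mem_L_mem_R_or hk hj hA hB⟩

end SOS

theorem theorem8 (N k : ℕ) (hk : 2 ≤ k) (hN : k < N) :
    (SOS.mip N k).IsFormulationOf (SOS.sosk k N) ∧
    (SOS.mip N k).IsIdeal ∧
    (Fintype.card (SOS.Idx N k) : ℤ) ≤ ⌈Real.logb 2 ((N : ℝ) - k + 1)⌉ + k - 2 ∧
    (Fintype.card (SOS.Idx N k ⊕ SOS.Idx N k) : ℤ) ≤
      2 * ⌈Real.logb 2 ((N : ℝ) - k + 1)⌉ + 2 * k - 4 := by
  have hcard := SOS.card_Idx_le (N := N) hk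
  have hbits := SOS.bits_cast hN
  refine ⟨?_, ?_, by omega, by rw [Fintype.card_sum]; omega⟩
  · rw [SOS.mip_eq_ofPairs]
    refine (SimplexMIP.isFormulationOf_ofPairs _ _).trans (Set.ext fun x => Iff.symm ?_)
    rw [SOS.mem_sosk_iff hk hN]
    refine and_congr_right fun _ => ⟨fun h s u hu v hv => ?_, fun h u v huv => ?_⟩
    · rcases SOS.far_of_mem_L_of_mem_R s.1.2 hk hu hv with huv | hvu
      · exact h u v huv
      · exact (h v u hvu).symm
    · have hu := Finset.mem_Icc.1 u.2
      have hv := Finset.mem_Icc.1 v.2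
      obtain ⟨s, ⟨h1, h2⟩ | ⟨h1, h2⟩⟩ := SOS.exists_Idx_separating hk hN hu.1 hv.2 huv
      · exact h s u h1 v h2
      · exact (h s v h1 u h2).symm
  · rw [SOS.mip_eq_ofPairs]
    -- A common element would be at distance at least `k > 0` from itself.
    refine SimplexMIP.isIdeal_ofPairs fun s => Set.disjoint_left.2 fun u hu hv => ?_
    rcases SOS.far_of_mem_L_of_mem_R s.1.2 hk hu hv with h | h <;> omega
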